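/- Consider the following online communication problem (online set intersection) with parameters $n,k$. Alice is given a set $X\subseteq[n]$ with $|X|=k$. There are $k$ stages. At the beginning of stage $i$ an element $Y_i\in[n]$ is revealed to Bob; the players then exchange bits as in the classical two-party communication model (remembering everything from earlier stages), after which Bob must output whether $Y_i\in X$; then $Y_i$ is revealed to Alice and the next stage begins. In a public-coin protocol both players also see a common random string; the protocol has zero error if on every input $(X,Y_1,\dots,Y_k)$ all $k$ outputs of Bob are correct with probability $1$. The cost on an input is the total number of bits exchanged in all stages. There are an absolute constant $c>0$ and a $k_0$ such that for all $k\ge k_0$, all $n\ge k^2$, and every zero-error public-coin protocol for this problem, there is an input $(X,Y_1,\dots,Y_k)$ on which the expected cost (over the public randomness) is at least $c\,k\log\log k$. In other words, the worst-case expected total communication is $\Omega(k\log\log k)$. Moreover, the input can be chosen with $Y_i\notin X$ for all $i$. -/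

import Mathlib

open MeasureTheory

namespace OnlineComm

/-- A deterministic two-party protocol tree for one stage.  `𝒳` is the input of Alice, `𝒴` the input
of Bob in this stage.  At an inner node the owner of the node sends one bit, computed from the
owner's input, and the players continue in the first subtree (bit `false`) or in the second one
(bit `true`).  At a leaf Bob computes his output from his own input. -/
inductive StageProtocol (𝒳 𝒴 𝒵 : Type) : Type
  | leaf (out : 𝒴 → 𝒵) : StageProtocol 𝒳 𝒴 𝒵
  | alice (bit : 𝒳 → Bool) (t₀ t₁ : StageProtocol 𝒳 𝒴 𝒵) : StageProtocol 𝒳 𝒴 𝒵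
  | bob (bit : 𝒴 → Bool) (t₀ t₁ : StageProtocol 𝒳 𝒴 𝒵) : StageProtocol 𝒳 𝒴 𝒵

namespace StageProtocol

variable {𝒳 𝒴 𝒵 : Type}

/-- The sequence of bits exchanged on inputs `x`, `y`. -/
def transcript : StageProtocol 𝒳 𝒴 𝒵 → 𝒳 → 𝒴 → List Bool
  | leaf _, _, _ => []
  | alice b t₀ t₁, x, y => b x :: bif b x then t₁.transcript x y else t₀.transcript x y
  | bob b t₀ t₁, x, y => b y :: bif b y then t₁.transcript x y else t₀.transcript x y

/-- Bob's output on inputs `x`, `y`. -/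
def output : StageProtocol 𝒳 𝒴 𝒵 → 𝒳 → 𝒴 → 𝒵
  | leaf o, _, y => o y
  | alice b t₀ t₁, x, y => bif b x then t₁.output x y else t₀.output x y
  | bob b t₀ t₁, x, y => bif b y then t₁.output x y else t₀.output x y

end StageProtocol

/-- What both players know when a stage begins: for every earlier stage, in order, its transcript
and the piece of Bob's input in that stage (which is revealed to Alice at the end of the stage). -/
abbrev History (𝒴 : Type) : Type := List (List Bool × 𝒴)

/-- A deterministic online protocol: the common history determines the protocol tree that the
players use in the coming stage (the index of that stage is the length of the history). -/
structure OnlineProtocol (𝒳 𝒴 𝒵 : Type) : Type where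
  stage : History 𝒴 → StageProtocol 𝒳 𝒴 𝒵

namespace OnlineProtocol

variable {𝒳 𝒴 𝒵 : Type} {k : ℕ}

/-- The common history after the first `i` stages, on Alice's input `x` and Bob's inputs
`y 0, …, y (k - 1)`. -/
def history (P : OnlineProtocol 𝒳 𝒴 𝒵) (x : 𝒳) (y : Fin k → 𝒴) : (i : ℕ) → i ≤ k → History 𝒴
  | 0, _ => []
  | i + 1, hi =>
      let h := P.history x y i (Nat.le_of_succ_le hi)
      h ++ [((P.stage h).transcript x (y ⟨i, hi⟩), y ⟨i, hi⟩)]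

/-- The protocol tree used in stage `i`. -/
def stageAt (P : OnlineProtocol 𝒳 𝒴 𝒵) (x : 𝒳) (y : Fin k → 𝒴) (i : Fin k) :
    StageProtocol 𝒳 𝒴 𝒵 :=
  P.stage (P.history x y i i.isLt.le)

/-- Bob's output in stage `i`. -/
def output (P : OnlineProtocol 𝒳 𝒴 𝒵) (x : 𝒳) (y : Fin k → 𝒴) (i : Fin k) : 𝒵 :=
  (P.stageAt x y i).output x (y i)

/-- The total number of bits exchanged in all `k` stages. -/
def cost (P : OnlineProtocol 𝒳 𝒴 𝒵) (x : 𝒳) (y : Fin k → 𝒴) : ℕ :=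
  ∑ i : Fin k, ((P.stageAt x y i).transcript x (y i)).length

end OnlineProtocol

/-- A public-coin online protocol with `k` stages: the public random string `ω : Ω` selects a
deterministic online protocol; on every input the total communication is a random variable. -/
structure PublicCoinProtocol (Ω : Type*) [MeasurableSpace Ω] (𝒳 𝒴 𝒵 : Type) (k : ℕ) where
  protocol : Ω → OnlineProtocol 𝒳 𝒴 𝒵
  measurable_cost : ∀ (x : 𝒳) (y : Fin k → 𝒴), Measurable fun ω => (protocol ω).cost x y

namespace PublicCoinProtocol

variable {Ω : Type*} [MeasurableSpace Ω] {𝒳 𝒴 𝒵 : Type} {k : ℕ}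

/-- Zero error for the online problem of computing `f i x (y i)` in stage `i`: on every input,
all of Bob's outputs are correct with probability one. -/
def ZeroError (P : PublicCoinProtocol Ω 𝒳 𝒴 𝒵 k) (μ : Measure Ω) (f : Fin k → 𝒳 → 𝒴 → 𝒵) : Prop :=
  ∀ (x : 𝒳) (y : Fin k → 𝒴), ∀ᵐ ω ∂μ, ∀ i : Fin k, (P.protocol ω).output x y i = f i x (y i)

/-- The expected total communication on a given input (possibly infinite). -/
noncomputable def expectedCost (P : PublicCoinProtocol Ω 𝒳 𝒴 𝒵 k) (μ : Measure Ω)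
    (x : 𝒳) (y : Fin k → 𝒴) : ENNReal :=
  ∫⁻ ω, ((P.protocol ω).cost x y : ENNReal) ∂μ

end PublicCoinProtocol

/-- Alice's inputs in online set intersection: the `k`-element subsets of an `n`-element universe. -/
abbrev KSubset (n k : ℕ) : Type := {X : Finset (Fin n) // X.card = k}

/-- Online set intersection: in every stage Bob has to decide whether his element is in `X`. -/
def osi (n k : ℕ) : Fin k → KSubset n k → Fin n → Bool :=
  fun _ X y => decide (y ∈ X.1)

end OnlineComm

/-! Fix a correct deterministic protocol and average over disjoint inputs (`Y i ∉ X` for all `i`).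
Before stage `i`, the at most `L` bits exchanged, together with Alice's strategy in the first `ℓ`
levels of the tree (one of `2 ^ 2 ^ ℓ`), determine Bob's answer on every cheap element, one settled
within `ℓ` bits. If fewer than `n / r` elements outside `X` are expensive, these data confine `X` to
a fixed set of size at most `2 * n / r`, which catches only a `(2 / r) ^ k` fraction of all `X`
(`card_exceptional_fiber_le`). A union bound makes such `X` rare.

So either half of the inputs cost more than `L`, or in every stage a quarter of them have `n / r`
expensive elements; `Y i` being still free, resampling it forces average stage cost at least `ℓ / (4
* r)` (`sum_stageCost_ge`). With `ℓ ≈ log k`, `r ≈ √(log k)` and `L ≈ k * log r`, both cases give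
order `k log log k`. Averaging over the coins then yields one bad input. -/

namespace OnlineComm

open Finset

/-! ### Protocol trees and Alice's truncated strategies -/

namespace StageProtocol

variable {𝒳 𝒴 𝒵 : Type}

/-- For a fixed input of Bob, the transcripts of a stage form a prefix-free set. -/
theorem transcript_append_inj (t : StageProtocol 𝒳 𝒴 𝒵) {x x' : 𝒳} {y : 𝒴} {u u' : List Bool}
    (h : t.transcript x y ++ u = t.transcript x' y ++ u') :
    t.transcript x y = t.transcript x' y ∧ u = u' := by
  induction t with
  | leaf o => simpa [transcript] using h
  | alice b t₀ t₁ ih₀ ih₁ =>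
    cases hb : b x <;> cases hb' : b x' <;> simp [transcript, hb, hb'] at h ⊢
    · exact ih₀ h
    · exact ih₁ h
  | bob b t₀ t₁ ih₀ ih₁ =>
    cases hb : b y <;> simp [transcript, hb] at h ⊢
    · exact ih₀ h
    · exact ih₁ h

/-- Alice's strategy in the first `ℓ` levels of a protocol tree can be described by an element of a
set of size `2 ^ 2 ^ ℓ`, and it determines the course of all runs with at most `ℓ` bits. -/
theorem exists_strategy_code (t : StageProtocol 𝒳 𝒴 𝒵) (ℓ : ℕ) :
    ∃ σ : 𝒳 → Fin (2 ^ 2 ^ ℓ), ∀ x x' : 𝒳, σ x = σ x' → ∀ y : 𝒴,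
      (t.transcript x y).length ≤ ℓ →
        t.transcript x' y = t.transcript x y ∧ t.output x' y = t.output x y := by
  induction t generalizing ℓ with
  | leaf o => exact ⟨fun _ => ⟨0, by positivity⟩, by simp [transcript, output]⟩
  | alice b t₀ t₁ ih₀ ih₁ =>
    cases ℓ with
    | zero => exact ⟨fun _ => ⟨0, by positivity⟩, by simp [transcript]⟩
    | succ ℓ =>
      obtain ⟨σ₀, h₀⟩ := ih₀ ℓ
      obtain ⟨σ₁, h₁⟩ := ih₁ ℓ
      have hcard : Fintype.card (Bool × Fin (2 ^ 2 ^ ℓ)) ≤ Fintype.card (Fin (2 ^ 2 ^ (ℓ + 1))) := by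
        simp only [Fintype.card_prod, Fintype.card_bool, Fintype.card_fin]
        rw [← pow_succ']
        refine Nat.pow_le_pow_right (by norm_num) ?_
        have := Nat.one_le_two_pow (n := ℓ)
        rw [pow_succ]; omega
      obtain ⟨e⟩ := Function.Embedding.nonempty_of_card_le hcard
      refine ⟨fun x => e (b x, bif b x then σ₁ x else σ₀ x), fun x x' hx y hl => ?_⟩
      have hx := e.injective hx
      rw [Prod.mk.injEq] at hx
      obtain ⟨hb, hs⟩ := hx
      cases hbx : b x <;> rw [hbx] at hb <;>
        simp only [hbx, ← hb, cond_true, cond_false, transcript, output, List.length_cons,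
          List.cons.injEq, true_and, add_le_add_iff_right] at hs hl ⊢
      · exact h₀ x x' hs y hl
      · exact h₁ x x' hs y hl
  | bob b t₀ t₁ ih₀ ih₁ =>
    cases ℓ with
    | zero => exact ⟨fun _ => ⟨0, by positivity⟩, by simp [transcript]⟩
    | succ ℓ =>
      obtain ⟨σ₀, h₀⟩ := ih₀ ℓ
      obtain ⟨σ₁, h₁⟩ := ih₁ ℓ
      have hcard : Fintype.card (Fin (2 ^ 2 ^ ℓ) × Fin (2 ^ 2 ^ ℓ)) ≤
          Fintype.card (Fin (2 ^ 2 ^ (ℓ + 1))) := by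
        simp only [Fintype.card_prod, Fintype.card_fin]
        rw [← pow_add, pow_succ, mul_two]
      obtain ⟨e⟩ := Function.Embedding.nonempty_of_card_le hcard
      refine ⟨fun x => e (σ₀ x, σ₁ x), fun x x' hx y hl => ?_⟩
      have hx := e.injective hx
      rw [Prod.mk.injEq] at hx
      cases hbx : b y <;>
        simp only [hbx, cond_true, cond_false, transcript, output, List.length_cons,
          List.cons.injEq, true_and, add_le_add_iff_right] at hl ⊢
      · exact h₀ x x' hx.1 y hl
      · exact h₁ x x' hx.2 y hl

/-- A description of Alice's strategy in the first `ℓ` levels of a protocol tree. -/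
noncomputable def strategyCode (t : StageProtocol 𝒳 𝒴 𝒵) (ℓ : ℕ) : 𝒳 → Fin (2 ^ 2 ^ ℓ) :=
  (t.exists_strategy_code ℓ).choose

theorem strategyCode_spec (t : StageProtocol 𝒳 𝒴 𝒵) {ℓ : ℕ} {x x' : 𝒳}
    (h : t.strategyCode ℓ x = t.strategyCode ℓ x') {y : 𝒴} (hy : (t.transcript x y).length ≤ ℓ) :
    t.transcript x' y = t.transcript x y ∧ t.output x' y = t.output x y :=
  (t.exists_strategy_code ℓ).choose_spec x x' h y hy

end StageProtocol

/-- All bits exchanged in a history, in order. -/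
def History.bits {𝒴 : Type} (h : History 𝒴) : List Bool :=
  h.flatMap Prod.fst

/-! ### Histories and their bit strings -/

namespace OnlineProtocol

variable {𝒳 𝒴 𝒵 : Type} {k : ℕ} (P : OnlineProtocol 𝒳 𝒴 𝒵)

theorem history_congr (x : 𝒳) {y y' : Fin k → 𝒴} (i : ℕ) (hi : i ≤ k)
    (h : ∀ j : Fin k, (j : ℕ) < i → y j = y' j) : P.history x y i hi = P.history x y' i hi := by
  induction i with
  | zero => rfl
  | succ i ih =>
    simp only [history]
    rw [ih _ fun j hj => h j (by omega), h ⟨i, hi⟩ (by simp)]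

/-- The tree of stage `i` is fixed before Bob's element arrives, so that element can be varied
freely. -/
theorem stageAt_update (x : 𝒳) (y : Fin k → 𝒴) (i : Fin k) (z : 𝒴) :
    P.stageAt x (Function.update y i z) i = P.stageAt x y i := by
  unfold stageAt
  rw [P.history_congr x]
  intro j hj
  exact Function.update_of_ne (Fin.ne_of_lt hj) _ _

-- The trailing words `u`, `u'` let prefix-freeness recover the stage boundaries by induction.
theorem bits_append_inj {x x' : 𝒳} {y : Fin k → 𝒴} (i : ℕ) (hi : i ≤ k) {u u' : List Bool}
    (h : (P.history x y i hi).bits ++ u = (P.history x' y i hi).bits ++ u') :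
    P.history x y i hi = P.history x' y i hi ∧ u = u' := by
  induction i generalizing u u' with
  | zero => simpa [history, History.bits] using h
  | succ i ih =>
    simp only [history, History.bits, List.flatMap_append, List.flatMap_cons, List.flatMap_nil,
      List.append_nil, List.append_assoc] at h ⊢
    obtain ⟨h₁, h₂⟩ := ih _ h
    rw [← h₁] at h₂ ⊢
    obtain ⟨h₃, h₄⟩ := StageProtocol.transcript_append_inj _ h₂
    exact ⟨by rw [h₃], h₄⟩

theorem bits_injective {x x' : 𝒳} {y : Fin k → 𝒴} (i : ℕ) (hi : i ≤ k)
    (h : (P.history x y i hi).bits = (P.history x' y i hi).bits) :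
    P.history x y i hi = P.history x' y i hi :=
  (P.bits_append_inj i hi (u := []) (u' := []) (by simpa using h)).1

/-- The number of bits exchanged in stage `i`. -/
def stageCost (x : 𝒳) (y : Fin k → 𝒴) (i : Fin k) : ℕ :=
  ((P.stageAt x y i).transcript x (y i)).length

theorem length_bits_eq (x : 𝒳) (y : Fin k → 𝒴) (i : ℕ) (hi : i ≤ k) :
    (P.history x y i hi).bits.length =
      ∑ j : Fin i, P.stageCost x y ⟨j, j.2.trans_le hi⟩ := by
  induction i with
  | zero => simp [history, History.bits]
  | succ i ih =>
    rw [Fin.sum_univ_castSucc]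
    simp only [history, History.bits, List.flatMap_append, List.flatMap_cons, List.flatMap_nil,
      List.append_nil, List.length_append]
    exact congrArg₂ _ (ih _) rfl

theorem length_bits_le_cost (x : 𝒳) (y : Fin k → 𝒴) (i : ℕ) (hi : i ≤ k) :
    (P.history x y i hi).bits.length ≤ P.cost x y := by
  rw [length_bits_eq, cost]
  exact (sum_map univ (Fin.castLEEmb hi) (P.stageCost x y)).symm.le.trans
    (sum_le_sum_of_subset (subset_univ _))

end OnlineProtocol

/-! ### Counting estimates -/

theorem card_boolLists_le (L : ℕ) :
    ∃ S : Finset (List Bool), (∀ l : List Bool, l.length ≤ L → l ∈ S) ∧ #S ≤ 2 ^ (L + 1) := by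
  refine ⟨(range (L + 1)).biUnion fun j =>
    (univ : Finset (List.Vector Bool j)).image List.Vector.toList, fun l hl => ?_, ?_⟩
  · simp only [mem_biUnion, mem_range, mem_image, mem_univ, true_and]
    exact ⟨l.length, by omega, ⟨l, rfl⟩, rfl⟩
  · refine card_biUnion_le.trans ((sum_le_sum fun j _ => card_image_le).trans ?_)
    simp only [card_univ, card_vector, Fintype.card_bool]
    exact (Nat.geomSum_lt le_rfl (by simp)).le

theorem descFactorial_mul_pow_le {m n : ℕ} (h : m ≤ n) (k : ℕ) :
    m.descFactorial k * n ^ k ≤ n.descFactorial k * m ^ k := by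
  induction k with
  | zero => simp
  | succ k ih =>
    have h' : (m - k) * n ≤ (n - k) * m := by
      rw [Nat.sub_mul, Nat.sub_mul, mul_comm n m]
      exact Nat.sub_le_sub_left (Nat.mul_le_mul_left _ h) _
    calc _ = ((m - k) * n) * (m.descFactorial k * n ^ k) := by
          rw [Nat.descFactorial_succ, pow_succ]; ring
      _ ≤ ((n - k) * m) * (n.descFactorial k * m ^ k) := Nat.mul_le_mul h' ih
      _ = _ := by rw [Nat.descFactorial_succ, pow_succ]; ring

/-- A random `k`-subset of an `n`-set lies in a given `m`-subset with probability at most `(m / n) ^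
k`. -/
theorem choose_mul_pow_le {m n : ℕ} (h : m ≤ n) (k : ℕ) :
    m.choose k * n ^ k ≤ n.choose k * m ^ k := by
  have := descFactorial_mul_pow_le h k
  rw [Nat.descFactorial_eq_factorial_mul_choose, Nat.descFactorial_eq_factorial_mul_choose,
    mul_assoc, mul_assoc] at this
  exact Nat.le_of_mul_le_mul_left this k.factorial_pos

/-- Here `n / (n - k) ≤ 1 + 2 / k`, and `(1 + 2 / k) ^ k ≤ e ^ 2 < 16`. This is the price of passing
from all `Y` to those avoiding `X`. -/
theorem pow_le_mul_sub_pow {n k : ℕ} (hk : 2 ≤ k) (hn : k ^ 2 ≤ n) :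
    n ^ k ≤ 16 * (n - k) ^ k := by
  have hkn : k ≤ n := by nlinarith
  have hk' : (0 : ℝ) < k := by positivity
  have h₁ : (n : ℝ) ≤ (n - k : ℕ) * Real.exp (2 / k) := by
    have h₂ : (2 : ℝ) / k + 1 ≤ Real.exp (2 / k) := Real.add_one_le_exp _
    have h₃ : (n : ℝ) ≤ (n - k : ℕ) * (2 / k + 1) := by
      rw [Nat.cast_sub hkn, div_add_one hk'.ne', mul_div_assoc', le_div_iff₀ hk']
      have h₄ : (k : ℝ) ^ 2 ≤ n := by exact_mod_cast hn
      have h₅ : (2 : ℝ) ≤ k := by exact_mod_cast hk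
      nlinarith
    exact h₃.trans (mul_le_mul_of_nonneg_left h₂ (by positivity))
  have h₆ : Real.exp (2 / k) ^ k ≤ 16 := by
    rw [← Real.exp_nat_mul, mul_div_cancel₀ _ hk'.ne']
    have h₇ : Real.exp 2 = Real.exp 1 * Real.exp 1 := by rw [← Real.exp_add]; norm_num
    nlinarith [Real.exp_one_lt_d9, Real.exp_pos 1]
  have h₈ := pow_le_pow_left₀ (by positivity) h₁ k
  rw [mul_pow] at h₈
  have h₉ : (n : ℝ) ^ k ≤ (n - k : ℕ) ^ k * 16 :=
    h₈.trans (mul_le_mul_of_nonneg_left h₆ (by positivity))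
  rw [mul_comm]
  exact_mod_cast h₉

/-- A double-counting identity: resampling one coordinate of a uniform vector. -/
theorem sum_piFinset_update {k : ℕ} {α : Type*} [DecidableEq α] (S : Finset α) (i : Fin k)
    (f : (Fin k → α) → ℕ) :
    ∑ y ∈ Fintype.piFinset fun _ : Fin k => S, ∑ z ∈ S, f (Function.update y i z) =
      #S * ∑ y ∈ Fintype.piFinset fun _ : Fin k => S, f y := by
  have h : #S * ∑ y ∈ Fintype.piFinset fun _ : Fin k => S, f y =
      ∑ y ∈ Fintype.piFinset fun _ : Fin k => S, ∑ _z ∈ S, f y := by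
    simp [mul_sum]
  rw [h, ← sum_product', ← sum_product']
  have hmem : ∀ p ∈ (Fintype.piFinset fun _ : Fin k => S) ×ˢ S,
      (Function.update p.1 i p.2, p.1 i) ∈ (Fintype.piFinset fun _ : Fin k => S) ×ˢ S := by
    rintro ⟨y, z⟩ hp
    simp only [mem_product, Fintype.mem_piFinset] at hp ⊢
    refine ⟨fun j => ?_, hp.1 i⟩
    by_cases hj : j = i
    · subst hj; simpa using hp.2
    · simpa [Function.update_of_ne hj] using hp.1 j
  -- Exchanging `y i` with `z` is an involution.
  refine sum_nbij' (fun p => (Function.update p.1 i p.2, p.1 i))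
    (fun p => (Function.update p.1 i p.2, p.1 i)) hmem hmem ?_ ?_ ?_ <;> simp

/-! ### Deterministic protocols on disjoint inputs -/

section Deterministic

variable {n k : ℕ} (P : OnlineProtocol (KSubset n k) (Fin n) Bool)

/-- The elements outside of `X` that need more than `ℓ` bits as Bob's input in stage `i`. -/
def expensive (ℓ : ℕ) (X : KSubset n k) (Y : Fin k → Fin n) (i : Fin k) : Finset (Fin n) :=
  {z ∈ X.1ᶜ | ℓ < ((P.stageAt X Y i).transcript X z).length}

/-- The inputs of Alice for which little has been said before stage `i`, and yet all but an
`1 / r`-fraction of the elements are cheap in stage `i`. -/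
def exceptional (L ℓ r : ℕ) (Y : Fin k → Fin n) (i : Fin k) : Finset (KSubset n k) :=
  {X | (P.history X Y i i.isLt.le).bits.length ≤ L ∧ #(expensive P ℓ X Y i) * r < n}

variable {P}

theorem card_exceptional_fiber_le (hP : ∀ X Y i, P.output X Y i = osi n k i X (Y i))
    {ℓ r : ℕ} (hr : k * r ≤ n) (Y : Fin k → Fin n) (i : Fin k) (F : Finset (KSubset n k))
    (hF : ∀ X ∈ F, #(expensive P ℓ X Y i) * r < n)
    (hhist : ∀ X ∈ F, ∀ X' ∈ F, P.stageAt X Y i = P.stageAt X' Y i)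
    (hcode : ∀ X ∈ F, ∀ X' ∈ F,
      (P.stageAt X Y i).strategyCode ℓ X = (P.stageAt X Y i).strategyCode ℓ X') :
    #F * r ^ k ≤ 2 ^ k * n.choose k := by
  obtain rfl | ⟨X₀, hX₀⟩ := F.eq_empty_or_nonempty
  · simp
  have hout : ∀ (X : KSubset n k) (z : Fin n),
      (P.stageAt X Y i).output X z = decide (z ∈ X.1) := by
    intro X z
    have := hP X (Function.update Y i z) i
    rwa [OnlineProtocol.output, P.stageAt_update, Function.update_self] at this
  -- Outside `M`, Bob answers "no" for `X₀` within `ℓ` bits, hence also for every `X ∈ F`;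
  -- correctness forces `X ⊆ M`.
  set M : Finset (Fin n) := X₀.1 ∪ expensive P ℓ X₀ Y i with hM
  have hsub : ∀ X ∈ F, X.1 ⊆ M := by
    intro X hX z hz
    by_contra hzM
    simp only [hM, expensive, mem_union, mem_filter, mem_compl, not_or, not_and, not_lt] at hzM
    obtain ⟨hz₀, hcheap⟩ := hzM
    have h := (StageProtocol.strategyCode_spec _ (hcode X₀ hX₀ X hX) (hcheap hz₀)).2
    rw [hhist X₀ hX₀ X hX, hout X z, ← hhist X₀ hX₀ X hX, hout X₀ z] at h
    simp [hz, hz₀] at h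
  have hcard : #F ≤ (#M).choose k := by
    rw [← card_powersetCard, ← card_map (Function.Embedding.subtype _)]
    refine card_le_card fun X hX => ?_
    simp only [mem_map, Function.Embedding.subtype_apply] at hX
    obtain ⟨X, hX, rfl⟩ := hX
    exact mem_powersetCard.2 ⟨hsub X hX, X.2⟩
  have hMr : #M * r ≤ 2 * n := by
    have h₁ : #M ≤ k + #(expensive P ℓ X₀ Y i) := (card_union_le _ _).trans (by rw [X₀.2])
    have h₂ := hF X₀ hX₀
    nlinarith
  have hMn : #M ≤ n := by simpa using card_le_univ M
  have hn : 0 < n := (Nat.zero_le _).trans_lt (hF X₀ hX₀)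
  refine Nat.le_of_mul_le_mul_right (c := n ^ k) ?_ (by positivity)
  calc #F * r ^ k * n ^ k ≤ (#M).choose k * r ^ k * n ^ k := by gcongr
    _ = (#M).choose k * n ^ k * r ^ k := by ring
    _ ≤ n.choose k * #M ^ k * r ^ k := Nat.mul_le_mul_right _ (choose_mul_pow_le hMn k)
    _ = n.choose k * (#M * r) ^ k := by rw [mul_pow]; ring
    _ ≤ n.choose k * (2 * n) ^ k := by gcongr
    _ = 2 ^ k * n.choose k * n ^ k := by rw [mul_pow]; ring

/-- Union bound over the pairs (bits so far, strategy code). -/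
theorem card_exceptional_le (hP : ∀ X Y i, P.output X Y i = osi n k i X (Y i))
    {L ℓ r : ℕ} (hr : k * r ≤ n) (Y : Fin k → Fin n) (i : Fin k) :
    #(exceptional P L ℓ r Y i) * r ^ k ≤ 2 ^ (L + 1 + 2 ^ ℓ + k) * n.choose k := by
  obtain ⟨S, hS, hScard⟩ := card_boolLists_le L
  let code : KSubset n k → List Bool × Fin (2 ^ 2 ^ ℓ) := fun X =>
    ((P.history X Y i i.isLt.le).bits, (P.stageAt X Y i).strategyCode ℓ X)
  have hmaps : ∀ X ∈ exceptional P L ℓ r Y i, code X ∈ S ×ˢ (univ : Finset (Fin (2 ^ 2 ^ ℓ))) := by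
    intro X hX
    simp only [exceptional, mem_filter, mem_univ, true_and] at hX
    exact mem_product.2 ⟨hS _ hX.1, mem_univ _⟩
  have hfib : ∀ c ∈ S ×ˢ (univ : Finset (Fin (2 ^ 2 ^ ℓ))),
      #{X ∈ exceptional P L ℓ r Y i | code X = c} * r ^ k ≤ 2 ^ k * n.choose k := by
    intro c _
    have hstage : ∀ X X', code X = c → code X' = c → P.stageAt X Y i = P.stageAt X' Y i := by
      intro X X' h h'
      have := congrArg Prod.fst (h.trans h'.symm)
      exact congrArg P.stage (P.bits_injective _ _ this)
    refine card_exceptional_fiber_le (ℓ := ℓ) hP hr Y i _ ?_ ?_ ?_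
    · intro X hX
      simp only [exceptional, mem_filter, mem_univ, true_and] at hX
      exact hX.1.2
    · intro X hX X' hX'
      exact hstage X X' (mem_filter.1 hX).2 (mem_filter.1 hX').2
    · intro X hX X' hX'
      have h := congrArg Prod.snd ((mem_filter.1 hX).2.trans (mem_filter.1 hX').2.symm)
      simp only [code] at h
      rw [h, hstage X X' (mem_filter.1 hX).2 (mem_filter.1 hX').2]
  rw [card_eq_sum_card_fiberwise hmaps, sum_mul]
  refine (sum_le_sum hfib).trans ?_
  rw [sum_const, smul_eq_mul, card_product, card_univ, Fintype.card_fin]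
  calc #S * 2 ^ 2 ^ ℓ * (2 ^ k * n.choose k)
      ≤ 2 ^ (L + 1) * 2 ^ 2 ^ ℓ * (2 ^ k * n.choose k) := by gcongr
    _ = _ := by rw [pow_add _ (L + 1 + 2 ^ ℓ), pow_add _ (L + 1)]; ring

/-- The inputs on which Bob never holds an element of Alice's set. -/
def disjointInputs (n k : ℕ) : Finset (Σ _ : KSubset n k, Fin k → Fin n) :=
  univ.sigma fun X => Fintype.piFinset fun _ => X.1ᶜ

theorem card_disjointInputs (n k : ℕ) : #(disjointInputs n k) = n.choose k * (n - k) ^ k := by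
  have h : ∀ X : KSubset n k, #(Fintype.piFinset fun _ : Fin k => X.1ᶜ) = (n - k) ^ k := by
    intro X
    rw [Fintype.card_piFinset_const, card_compl, X.2, Fintype.card_fin]
  rw [disjointInputs, card_sigma, sum_congr rfl fun X _ => h X]
  simp [Fintype.card_finset_len]

theorem card_exceptional_inputs_le (hP : ∀ X Y i, P.output X Y i = osi n k i X (Y i))
    {L ℓ r : ℕ} (hk : 2 ≤ k) (hn : k ^ 2 ≤ n) (hr : r ≤ k)
    (hparam : 2 ^ (L + 1 + 2 ^ ℓ + k + 6) ≤ r ^ k) (i : Fin k) :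
    4 * #{p ∈ disjointInputs n k | p.1 ∈ exceptional P L ℓ r p.2 i} ≤ #(disjointInputs n k) := by
  have hr' : k * r ≤ n := by nlinarith
  have hrk : 0 < r ^ k := lt_of_lt_of_le (by positivity) hparam
  -- `64 = 4 * 16`: the `16` is lost in restricting to disjoint inputs.
  have h₁ : ∀ Y, 64 * #(exceptional P L ℓ r Y i) ≤ n.choose k := by
    intro Y
    refine Nat.le_of_mul_le_mul_right (c := r ^ k) ?_ hrk
    calc 64 * #(exceptional P L ℓ r Y i) * r ^ k
        = 64 * (#(exceptional P L ℓ r Y i) * r ^ k) := by ring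
      _ ≤ 64 * (2 ^ (L + 1 + 2 ^ ℓ + k) * n.choose k) :=
          Nat.mul_le_mul_left _ (card_exceptional_le hP hr' Y i)
      _ = n.choose k * 2 ^ (L + 1 + 2 ^ ℓ + k + 6) := by rw [pow_add _ _ 6]; ring
      _ ≤ n.choose k * r ^ k := by gcongr
  have h₂ : #{p ∈ disjointInputs n k | p.1 ∈ exceptional P L ℓ r p.2 i} ≤
      ∑ Y : Fin k → Fin n, #(exceptional P L ℓ r Y i) := by
    rw [← card_sigma]
    refine card_le_card_of_injOn (fun p => ⟨p.2, p.1⟩) ?_ ?_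
    · intro p hp
      simp only [coe_filter, Set.mem_ofPred_eq] at hp
      simpa using hp.2
    · rintro ⟨X, Y⟩ _ ⟨X', Y'⟩ _ h
      simp only [Sigma.mk.injEq, heq_eq_eq] at h ⊢
      exact h.symm
  have h₃ : 64 * ∑ Y : Fin k → Fin n, #(exceptional P L ℓ r Y i) ≤ n ^ k * n.choose k := by
    rw [mul_sum]
    refine (sum_le_sum fun Y _ => h₁ Y).trans ?_
    simp
  have h₄ := Nat.mul_le_mul_right (n.choose k) (pow_le_mul_sub_pow hk hn)
  rw [card_disjointInputs]
  nlinarith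

theorem sum_stageCost_ge {ℓ r : ℕ} (i : Fin k) (hkn : k < n)
    (G : Finset (Σ _ : KSubset n k, Fin k → Fin n))
    (hG : G ⊆ disjointInputs n k) (hexp : ∀ p ∈ G, n ≤ #(expensive P ℓ p.1 p.2 i) * r) :
    #G * ℓ ≤ r * ∑ p ∈ disjointInputs n k, P.stageCost p.1 p.2 i := by
  have h₁ : ∑ p ∈ disjointInputs n k, ∑ z ∈ p.1.1ᶜ, P.stageCost p.1 (Function.update p.2 i z) i =
      (n - k) * ∑ p ∈ disjointInputs n k, P.stageCost p.1 p.2 i := by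
    rw [disjointInputs, sum_sigma, sum_sigma, mul_sum]
    refine sum_congr rfl fun X _ => ?_
    rw [sum_piFinset_update X.1ᶜ i fun Y => P.stageCost X Y i, card_compl, X.2, Fintype.card_fin]
  have h₂ : ∀ p ∈ G, n * ℓ ≤
      r * ∑ z ∈ p.1.1ᶜ, P.stageCost p.1 (Function.update p.2 i z) i := by
    intro p hp
    have h₃ : #(expensive P ℓ p.1 p.2 i) * ℓ ≤
        ∑ z ∈ p.1.1ᶜ, P.stageCost p.1 (Function.update p.2 i z) i := by
      rw [← smul_eq_mul]
      refine (card_nsmul_le_sum _ _ _ fun z hz => ?_).trans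
        (sum_le_sum_of_subset (filter_subset _ _))
      rw [OnlineProtocol.stageCost, P.stageAt_update, Function.update_self]
      exact (mem_filter.1 hz).2.le
    calc n * ℓ ≤ #(expensive P ℓ p.1 p.2 i) * r * ℓ := Nat.mul_le_mul_right _ (hexp p hp)
      _ = r * (#(expensive P ℓ p.1 p.2 i) * ℓ) := by ring
      _ ≤ _ := Nat.mul_le_mul_left _ h₃
  have h₄ : #G * (n * ℓ) ≤ r * ((n - k) * ∑ p ∈ disjointInputs n k, P.stageCost p.1 p.2 i) := by
    rw [← h₁, ← smul_eq_mul, mul_sum]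
    exact (card_nsmul_le_sum _ _ _ h₂).trans (sum_le_sum_of_subset hG)
  refine le_of_mul_le_mul_left (a := n) ?_ (by omega)
  calc n * (#G * ℓ) = #G * (n * ℓ) := by ring
    _ ≤ r * ((n - k) * ∑ p ∈ disjointInputs n k, P.stageCost p.1 p.2 i) := h₄
    _ ≤ r * (n * ∑ p ∈ disjointInputs n k, P.stageCost p.1 p.2 i) :=
        Nat.mul_le_mul_left _ (Nat.mul_le_mul_right _ (Nat.sub_le n k))
    _ = _ := by ring

theorem sum_cost_ge (hP : ∀ X Y i, P.output X Y i = osi n k i X (Y i))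
    {L ℓ r : ℕ} (hk : 2 ≤ k) (hn : k ^ 2 ≤ n) (hr : r ≤ k)
    (hparam : 2 ^ (L + 1 + 2 ^ ℓ + k + 6) ≤ r ^ k) :
    #(disjointInputs n k) * L ≤ 2 * ∑ p ∈ disjointInputs n k, P.cost p.1 p.2 ∨
      #(disjointInputs n k) * (k * ℓ) ≤ 4 * r * ∑ p ∈ disjointInputs n k, P.cost p.1 p.2 := by
  by_cases hcase : #(disjointInputs n k) ≤ 2 * #{p ∈ disjointInputs n k | L < P.cost p.1 p.2}
  · left
    have h₁ : #{p ∈ disjointInputs n k | L < P.cost p.1 p.2} * L ≤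
        ∑ p ∈ disjointInputs n k, P.cost p.1 p.2 := by
      rw [← smul_eq_mul]
      exact (card_nsmul_le_sum _ _ _ fun p hp => (mem_filter.1 hp).2.le).trans
        (sum_le_sum_of_subset (filter_subset _ _))
    calc _ ≤ 2 * #{p ∈ disjointInputs n k | L < P.cost p.1 p.2} * L :=
          Nat.mul_le_mul_right _ hcase
      _ ≤ _ := by rw [mul_assoc]; exact Nat.mul_le_mul_left _ h₁
  · right
    have hstage : ∀ i : Fin k, #(disjointInputs n k) * ℓ ≤
        4 * r * ∑ p ∈ disjointInputs n k, P.stageCost p.1 p.2 i := by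
      intro i
      set D := disjointInputs n k with hD
      set B := {p ∈ D | p.1 ∈ exceptional P L ℓ r p.2 i} with hB
      set C := {p ∈ D | L < P.cost p.1 p.2} with hC
      have hbad : 4 * #B ≤ #D := card_exceptional_inputs_le hP hk hn hr hparam i
      have hsub : #D - #(C ∪ B) ≤ #(D \ (C ∪ B)) := le_card_sdiff _ _
      have hun := card_union_le C B
      have hge := sum_stageCost_ge (P := P) (ℓ := ℓ) (r := r) i (by nlinarith) (D \ (C ∪ B))
        sdiff_subset (by
          intro p hp
          simp only [hC, hB, exceptional, mem_sdiff, mem_union, mem_filter, mem_univ, true_and,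
            not_or, not_and, not_lt] at hp
          exact hp.2.2 hp.1 ((P.length_bits_le_cost _ _ _ _).trans (hp.2.1 hp.1)))
      have hG : #D ≤ 4 * #(D \ (C ∪ B)) := by omega
      calc #D * ℓ ≤ 4 * #(D \ (C ∪ B)) * ℓ := Nat.mul_le_mul_right _ hG
        _ = 4 * (#(D \ (C ∪ B)) * ℓ) := by ring
        _ ≤ 4 * (r * ∑ p ∈ D, P.stageCost p.1 p.2 i) := Nat.mul_le_mul_left _ hge
        _ = _ := by ring
    calc #(disjointInputs n k) * (k * ℓ) = ∑ _i : Fin k, #(disjointInputs n k) * ℓ := by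
          rw [sum_const, card_univ, Fintype.card_fin, smul_eq_mul]; ring
      _ ≤ ∑ i : Fin k, 4 * r * ∑ p ∈ disjointInputs n k, P.stageCost p.1 p.2 i :=
          sum_le_sum fun i _ => hstage i
      _ = _ := by rw [← mul_sum, sum_comm]; rfl

/-- The average cost over all disjoint inputs of a correct deterministic protocol. -/
theorem sum_cost_ge_mul_log_log (hP : ∀ X Y i, P.output X Y i = osi n k i X (Y i))
    (hk : 2 ^ 256 ≤ k) (hn : k ^ 2 ≤ n) :
    #(disjointInputs n k) * (k * (Nat.log 2 (Nat.log 2 k) / 2)) ≤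
      8 * ∑ p ∈ disjointInputs n k, P.cost p.1 p.2 := by
  have hk7 : 7 ≤ k := le_trans (by norm_num) hk
  set ℓ := Nat.log 2 k with hℓ
  set s := Nat.log 2 ℓ / 2 with hs
  have hℓ256 : 256 ≤ ℓ := Nat.le_log_of_pow_le (by norm_num) hk
  have hs4 : 4 ≤ s := by
    have : 8 ≤ Nat.log 2 ℓ := Nat.le_log_of_pow_le (by norm_num) (le_trans (by norm_num) hℓ256)
    omega
  have hℓk : 2 ^ ℓ ≤ k := Nat.pow_log_le_self 2 (by omega)
  have hrr : 2 ^ s * 2 ^ s ≤ ℓ := by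
    rw [← pow_add]
    exact (Nat.pow_le_pow_right (by norm_num) (by omega)).trans
      (Nat.pow_log_le_self 2 (x := ℓ) (by omega))
  have hsr : s < 2 ^ s := Nat.lt_two_pow_self
  have hrk : 2 ^ s ≤ k := by
    have : ℓ < 2 ^ ℓ := Nat.lt_two_pow_self
    nlinarith
  -- The three spare copies of `k` absorb `2 ^ ℓ`, `k` and `7`.
  have hparam : 2 ^ ((s - 3) * k + 1 + 2 ^ ℓ + k + 6) ≤ (2 ^ s) ^ k := by
    rw [← pow_mul]
    refine Nat.pow_le_pow_right (by norm_num) ?_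
    obtain ⟨s', hs'⟩ : ∃ s', s = s' + 3 := ⟨s - 3, by omega⟩
    rw [hs', Nat.add_sub_cancel]
    nlinarith
  obtain h | h := sum_cost_ge hP (by omega) hn hrk hparam
  -- This needs `s ≥ 4`, whence the threshold `2 ^ 256`.
  · have : s ≤ 4 * (s - 3) := by omega
    calc #(disjointInputs n k) * (k * s) ≤ #(disjointInputs n k) * (k * (4 * (s - 3))) := by gcongr
      _ = 4 * (#(disjointInputs n k) * ((s - 3) * k)) := by ring
      _ ≤ 4 * (2 * ∑ p ∈ disjointInputs n k, P.cost p.1 p.2) := Nat.mul_le_mul_left _ h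
      _ = _ := by ring
  · refine le_of_mul_le_mul_left (a := 2 ^ s) ?_ (Nat.two_pow_pos s)
    have h₁ : 2 ^ s * s ≤ ℓ := le_trans (by gcongr) hrr
    calc 2 ^ s * (#(disjointInputs n k) * (k * s)) = #(disjointInputs n k) * (k * (2 ^ s * s)) := by
          ring
      _ ≤ #(disjointInputs n k) * (k * ℓ) := by gcongr
      _ ≤ 4 * 2 ^ s * ∑ p ∈ disjointInputs n k, P.cost p.1 p.2 := h
      _ ≤ 8 * 2 ^ s * ∑ p ∈ disjointInputs n k, P.cost p.1 p.2 := by gcongr; norm_num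
      _ = _ := by ring

end Deterministic

theorem log_log_le {k : ℕ} (hk : 2 ^ 256 ≤ k) :
    Real.log (Real.log k) ≤ 3 * (Nat.log 2 (Nat.log 2 k) / 2 : ℕ) := by
  set ℓ := Nat.log 2 k with hℓ
  have hℓ256 : 256 ≤ ℓ := Nat.le_log_of_pow_le (by norm_num) hk
  have hm : 8 ≤ Nat.log 2 ℓ := Nat.le_log_of_pow_le (by norm_num) (le_trans (by norm_num) hℓ256)
  have hlog : ∀ {a b : ℕ}, 0 < a → a ≤ 2 ^ b → Real.log a ≤ b := by
    intro a b ha hab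
    have h₁ : Real.log a ≤ Real.log (2 ^ b) :=
      Real.log_le_log (by exact_mod_cast ha) (by exact_mod_cast hab)
    rw [Real.log_pow] at h₁
    have h₂ : Real.log 2 ≤ 1 := by linarith [Real.log_two_lt_d9]
    nlinarith [(Nat.cast_nonneg b : (0 : ℝ) ≤ b)]
  have hk1 : (1 : ℝ) < k := by exact_mod_cast lt_of_lt_of_le (by norm_num) hk
  have h₁ : Real.log k ≤ (ℓ + 1 : ℕ) :=
    hlog (lt_of_lt_of_le (by norm_num) hk) (Nat.lt_pow_succ_log_self (by norm_num) k).le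
  have h₂ : Real.log (ℓ + 1 : ℕ) ≤ (Nat.log 2 ℓ + 1 : ℕ) :=
    hlog (by omega) (Nat.lt_pow_succ_log_self (by norm_num) ℓ)
  refine (Real.log_le_log (Real.log_pos hk1) h₁).trans (h₂.trans ?_)
  have h₃ : Nat.log 2 ℓ + 1 ≤ 3 * (Nat.log 2 ℓ / 2) := by omega
  exact_mod_cast h₃

end OnlineComm

/-! ### Averaging over the public coins -/

theorem mainTheorem3 :
    ∃ c : ℝ, 0 < c ∧ ∃ k₀ : ℕ, ∀ k n : ℕ, k₀ ≤ k → k ^ 2 ≤ n →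
      ∀ (Ω : Type*) [MeasurableSpace Ω] (μ : MeasureTheory.Measure Ω)
        [MeasureTheory.IsProbabilityMeasure μ]
        (P : OnlineComm.PublicCoinProtocol Ω (OnlineComm.KSubset n k) (Fin n) Bool k),
        P.ZeroError μ (OnlineComm.osi n k) →
        ∃ (X : OnlineComm.KSubset n k) (Y : Fin k → Fin n),
          (∀ i, Y i ∉ X.1) ∧
          ENNReal.ofReal (c * ((k : ℝ) * Real.log (Real.log (k : ℝ)))) ≤ P.expectedCost μ X Y := by
  -- `24 = 8 * 3`, from `sum_cost_ge_mul_log_log` and `log_log_le`.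
  refine ⟨1 / 24, by norm_num, 2 ^ 256, fun k n hk hn Ω _ μ _ P hP => ?_⟩
  set T := ENNReal.ofReal (1 / 24 * ((k : ℝ) * Real.log (Real.log (k : ℝ)))) with hT
  set D := OnlineComm.disjointInputs n k with hD
  have hk2 : 2 ≤ k := le_trans (by norm_num) hk
  have hkn : k < n := by nlinarith
  have hDne : D.Nonempty := by
    rw [← Finset.card_pos, hD, OnlineComm.card_disjointInputs]
    exact Nat.mul_pos (Nat.choose_pos hkn.le) (pow_pos (by omega) _)
  -- There are finitely many inputs, so almost every `ω` is correct on all of them at once.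
  have hcorrect : ∀ᵐ ω ∂μ, ∀ X Y i,
      (P.protocol ω).output X Y i = OnlineComm.osi n k i X (Y i) :=
    ae_all_iff.2 fun X => ae_all_iff.2 fun Y => hP X Y
  have hpoint : ∀ᵐ ω ∂μ, D.card * T ≤ ∑ p ∈ D, ((P.protocol ω).cost p.1 p.2 : ENNReal) := by
    filter_upwards [hcorrect] with ω hω
    have h₁ := OnlineComm.sum_cost_ge_mul_log_log hω hk hn
    have h₂ := OnlineComm.log_log_le hk
    rw [← Nat.cast_sum, hT, ← ENNReal.ofReal_natCast, ← ENNReal.ofReal_natCast,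
      ← ENNReal.ofReal_mul (by positivity)]
    refine ENNReal.ofReal_le_ofReal ?_
    have h₃ : (D.card : ℝ) * (k * (Nat.log 2 (Nat.log 2 k) / 2 : ℕ)) ≤
        8 * (∑ p ∈ D, (P.protocol ω).cost p.1 p.2 : ℕ) := by exact_mod_cast h₁
    have h₄ : (D.card : ℝ) * (k * Real.log (Real.log k)) ≤
        D.card * (k * (3 * (Nat.log 2 (Nat.log 2 k) / 2 : ℕ))) := by gcongr
    nlinarith
  have hsum : ∑ _p ∈ D, T ≤ ∑ p ∈ D, P.expectedCost μ p.1 p.2 := by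
    have hmeas : ∀ p ∈ D, Measurable fun ω => ((P.protocol ω).cost p.1 p.2 : ENNReal) :=
      fun p _ => (measurable_from_top (f := fun m : ℕ => (m : ENNReal))).comp
        (P.measurable_cost p.1 p.2)
    simp only [OnlineComm.PublicCoinProtocol.expectedCost]
    rw [← lintegral_finsetSum _ hmeas, Finset.sum_const, nsmul_eq_mul]
    calc (D.card : ENNReal) * T = ∫⁻ _, D.card * T ∂μ := by simp
      _ ≤ _ := lintegral_mono_ae hpoint
  obtain ⟨⟨X, Y⟩, hp, hle⟩ : ∃ p ∈ D, T ≤ P.expectedCost μ p.1 p.2 := by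
    by_contra! h
    exact hsum.not_gt (ENNReal.sum_lt_sum_of_nonempty hDne h)
  refine ⟨X, Y, fun i => ?_, hle⟩
  simp only [hD, OnlineComm.disjointInputs, Finset.mem_sigma, Fintype.mem_piFinset,
    Finset.mem_compl] at hp
  exact hp.2 i
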